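/- Let $\mathbb{K}$ be a field, let $\ell\ge 3$, and let $V=\mathbb{K}^{\ell}$. A (central) arrangement in a finite-dimensional vector space is a finite set of linear hyperplanes of that space. An arrangement $\mathcal{A}$ in $V$ is called reducible if there are a decomposition $V=V_1\oplus V_2$ with $V_1\neq 0\neq V_2$ and (possibly empty) arrangements $\mathcal{A}_i$ in $V_i$ $(i=1,2)$ such that $$\mathcal{A}=\mathcal{A}_1\times\mathcal{A}_2:=\{H_1\oplus V_2\mid H_1\in\mathcal{A}_1\}\cup\{V_1\oplus H_2\mid H_2\in\mathcal{A}_2\},$$ and irreducible otherwise. Let $S=\mathbb{K}[x_1,\dots,x_\ell]$, and for each hyperplane $H$ of $V$ let $\alpha_H\in S$ be a linear form with kernel $H$. An arrangement $\mathcal{B}$ in $V$ is called free if the $S$-module $$D(\mathcal{B})=\{\theta\in\operatorname{Der}_{\mathbb{K}}(S)\mid \theta(\alpha_H)\in S\cdot\alpha_H\ \text{for all } H\in\mathcal{B}\}$$ is free. Let $\mathcal{A}$ be an irreducible arrangement in $\mathbb{K}^{\ell}$ with $\ell\ge 3$. Then there exists a subarrangement $\mathcal{B}\subseteq\mathcal{A}$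 with $|\mathcal{B}|=\ell+1$ such that $$\operatorname{codim}_V(H_i\cap H_j\cap H_k)=3$$ whenever $H_i,H_j,H_k$ are three distinct hyperplanes in $\mathcal{B}$, and moreover this arrangement $\mathcal{B}$ is not free. -/

import Mathlib

/-- A central arrangement in `V`: a finite collection of linear hyperplanes of `V`. -/
@[ext]
structure CentralArrangement (K V : Type*) [Field K] [AddCommGroup V] [Module K V] where
  hyperplanes : Set (Submodule K V)
  finite : hyperplanes.Finite
  isHyperplane : ∀ H ∈ hyperplanes, IsCoatom H

namespace CentralArrangement

section Product

variable {K V W : Type*} [Field K] [AddCommGroup V] [Module K V] [AddCommGroup W] [Module K W]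

/-- `B` is a subarrangement of `A`. -/
def IsSubarrangement (B A : CentralArrangement K V) : Prop :=
  B.hyperplanes ⊆ A.hyperplanes

/-- The product arrangement in `V ⊕ W`:
`{H₁ ⊕ W | H₁ ∈ A₁} ∪ {V ⊕ H₂ | H₂ ∈ A₂}`. -/
def product (A₁ : CentralArrangement K V) (A₂ : CentralArrangement K W) :
    CentralArrangement K (V × W) where
  hyperplanes := (fun H₁ => H₁.prod ⊤) '' A₁.hyperplanes ∪
    (fun H₂ => Submodule.prod ⊤ H₂) '' A₂.hyperplanes
  finite := (A₁.finite.image _).union (A₂.finite.image _)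
  isHyperplane := by
    rintro H (⟨H₁, h, rfl⟩ | ⟨H₂, h, rfl⟩)
    · beta_reduce
      rw [← Submodule.comap_fst]
      exact (Submodule.isCoatom_comap_iff LinearMap.fst_surjective).2 (A₁.isHyperplane _ h)
    · beta_reduce
      rw [← Submodule.comap_snd]
      exact (Submodule.isCoatom_comap_iff LinearMap.snd_surjective).2 (A₂.isHyperplane _ h)

/-- Transport of an arrangement along a linear isomorphism. -/
def map (e : V ≃ₗ[K] W) (A : CentralArrangement K V) : CentralArrangement K W where
  hyperplanes := (fun H => H.map (e : V →ₗ[K] W)) '' A.hyperplanes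
  finite := A.finite.image _
  isHyperplane := by
    rintro _ ⟨H, h, rfl⟩
    exact ((Submodule.orderIsoMapComap e).isCoatom_iff H).2 (A.isHyperplane H h)

/-- `A` is reducible if `V = V₁ ⊕ V₂` with both summands nonzero and `A = A₁ × A₂` for
arrangements `A₁` in `V₁` and `A₂` in `V₂`. The factors may be empty arrangements. -/
def IsReducible (A : CentralArrangement K V) : Prop :=
  ∃ (V₁ V₂ : Submodule K V) (h : IsCompl V₁ V₂), V₁ ≠ ⊥ ∧ V₂ ≠ ⊥ ∧
    ∃ (A₁ : CentralArrangement K V₁) (A₂ : CentralArrangement K V₂),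
      A = (A₁.product A₂).map (Submodule.prodEquivOfIsCompl V₁ V₂ h)

/-- An arrangement is irreducible if it is not reducible. -/
def IsIrreducible (A : CentralArrangement K V) : Prop :=
  ¬ A.IsReducible

end Product

section Derivations

variable {K : Type*} [Field K] {l : ℕ}

/-- A linear form on `K^l`, as a homogeneous linear polynomial in the coordinates. -/
noncomputable def linearFormPoly (α : Module.Dual K (Fin l → K)) : MvPolynomial (Fin l) K :=
  ∑ i, MvPolynomial.C (α (Pi.single i 1)) * MvPolynomial.X i

/-- The logarithmic derivation module `D(A, m)` of a multiarrangement: the derivations `θ` of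
`S = K[x₁, …, x_l]` with `θ(α_H) ∈ S · α_H ^ m(H)` for all `H ∈ A`. The defining form `α_H` is
unique up to a nonzero scalar, which does not affect the condition. -/
noncomputable def logDerivations (A : CentralArrangement K (Fin l → K)) (m : A.hyperplanes → ℕ+) :
    Submodule (MvPolynomial (Fin l) K)
      (Derivation K (MvPolynomial (Fin l) K) (MvPolynomial (Fin l) K)) where
  carrier := {θ | ∀ (H : A.hyperplanes) (α : Module.Dual K (Fin l → K)),
    LinearMap.ker α = H.1 → linearFormPoly α ^ (m H : ℕ) ∣ θ (linearFormPoly α)}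
  zero_mem' := fun H α _ => by simp
  add_mem' := fun ha hb H α h => by
    rw [Derivation.add_apply]
    exact dvd_add (ha H α h) (hb H α h)
  smul_mem' := fun c θ hθ H α h => by
    rw [Derivation.smul_apply, smul_eq_mul]
    exact Dvd.dvd.mul_left (hθ H α h) c

/-- The multiarrangement `(A, m)` is free. -/
def IsFreeMultiplicity (A : CentralArrangement K (Fin l → K)) (m : A.hyperplanes → ℕ+) : Prop :=
  Module.Free (MvPolynomial (Fin l) K) (A.logDerivations m)

/-- An arrangement is free if it is free with the constant multiplicity `1`. -/
def IsFree (A : CentralArrangement K (Fin l → K)) : Prop :=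
  A.IsFreeMultiplicity (fun _ => 1)

end Derivations

end CentralArrangement

/-! The forms of an irreducible arrangement span the dual space, so some of them make up a basis
`b`. After at most one exchange in the basis, a further form `α` of the arrangement involves at
least three basis forms (`exists_basis_and_form`). Otherwise every form involves at most two, and
each index shares a form with at most one other; as `ℓ ≥ 3`, the forms then split into two blocks
and the arrangement is reducible (`isReducible_of_support`). Take `B` to be `b` together with `α`.
Any three of its forms are independent, because `α` involves a basis form outside any given pair.

For non-freeness (`not_isFree_of_basis_form`), three logarithmic derivations of polynomial degree
two satisfy a Koszul relation with coefficients `p i, p j, p k`, the basis forms. If `D(B)` were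
free, regularity of `p i` modulo `(p j, p k)` would give `u = p j • w + p k • w'` with `w, w'` in
`D(B)`. The linear part of `w` is diagonal in the basis and has `α` as an eigenvector, so its
eigenvalues agree on the support of `α`. The equation for `u` makes the eigenvalue nonzero at `k`
and zero at `i`, a contradiction. -/

namespace CentralArrangement

/-! ### Reducibility from a pair of complementary subspaces -/

section Reducibility

variable {K V : Type*} [Field K] [AddCommGroup V] [Module K V]

/-- By the modular law, a subspace containing one summand is recovered from its trace on the other.
-/
theorem map_prodEquivOfIsCompl_prod_top {V₁ V₂ H : Submodule K V} (h : IsCompl V₁ V₂)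
    (hH : V₂ ≤ H) :
    Submodule.map (Submodule.prodEquivOfIsCompl V₁ V₂ h : (V₁ × V₂) →ₗ[K] V)
      ((H.comap V₁.subtype).prod ⊤) = H := by
  refine le_antisymm ?_ fun x hx => ?_
  · rintro _ ⟨⟨a, b⟩, ⟨ha, -⟩, rfl⟩
    simpa using H.add_mem ha (hH b.2)
  · obtain ⟨⟨a, b⟩, rfl⟩ := (Submodule.prodEquivOfIsCompl V₁ V₂ h).surjective x
    refine ⟨(a, b), ⟨?_, trivial⟩, rfl⟩
    have := H.sub_mem hx (hH b.2)
    simpa using this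

theorem map_prodEquivOfIsCompl_top_prod {V₁ V₂ H : Submodule K V} (h : IsCompl V₁ V₂)
    (hH : V₁ ≤ H) :
    Submodule.map (Submodule.prodEquivOfIsCompl V₁ V₂ h : (V₁ × V₂) →ₗ[K] V)
      (Submodule.prod ⊤ (H.comap V₂.subtype)) = H := by
  refine le_antisymm ?_ fun x hx => ?_
  · rintro _ ⟨⟨a, b⟩, ⟨-, hb⟩, rfl⟩
    simpa using H.add_mem (hH a.2) hb
  · obtain ⟨⟨a, b⟩, rfl⟩ := (Submodule.prodEquivOfIsCompl V₁ V₂ h).surjective x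
    refine ⟨(a, b), ⟨trivial, ?_⟩, rfl⟩
    have := H.sub_mem hx (hH a.2)
    simpa using this

theorem isCoatom_comap_subtype_of_isCompl {V₁ V₂ H : Submodule K V} (h : IsCompl V₁ V₂)
    (hH : V₂ ≤ H) (hc : IsCoatom H) : IsCoatom (H.comap V₁.subtype) := by
  rw [← map_prodEquivOfIsCompl_prod_top h hH] at hc
  have := ((Submodule.orderIsoMapComap (Submodule.prodEquivOfIsCompl V₁ V₂ h)).isCoatom_iff _).1 hc
  rwa [← Submodule.comap_fst, Submodule.isCoatom_comap_iff LinearMap.fst_surjective] at this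

/-- An arrangement is reducible as soon as every hyperplane contains one of two nonzero
complementary subspaces. -/
theorem isReducible_of_isCompl (A : CentralArrangement K V) {V₁ V₂ : Submodule K V}
    (h : IsCompl V₁ V₂) (h₁ : V₁ ≠ ⊥) (h₂ : V₂ ≠ ⊥)
    (hA : ∀ H ∈ A.hyperplanes, V₁ ≤ H ∨ V₂ ≤ H) : A.IsReducible := by
  refine ⟨V₁, V₂, h, h₁, h₂,
    ⟨(fun H => H.comap V₁.subtype) '' {H ∈ A.hyperplanes | V₂ ≤ H},
      (A.finite.subset (Set.sep_subset _ _)).image _, ?_⟩,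
    ⟨(fun H => H.comap V₂.subtype) '' {H ∈ A.hyperplanes | V₁ ≤ H},
      (A.finite.subset (Set.sep_subset _ _)).image _, ?_⟩, ?_⟩
  · rintro _ ⟨H, ⟨hH, hle⟩, rfl⟩
    exact isCoatom_comap_subtype_of_isCompl h hle (A.isHyperplane H hH)
  · rintro _ ⟨H, ⟨hH, hle⟩, rfl⟩
    exact isCoatom_comap_subtype_of_isCompl h.symm hle (A.isHyperplane H hH)
  · ext H
    constructor
    · intro hH
      rcases hA H hH with hle | hle
      · exact ⟨_, Or.inr ⟨_, ⟨H, ⟨hH, hle⟩, rfl⟩, rfl⟩, map_prodEquivOfIsCompl_top_prod h hle⟩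
      · exact ⟨_, Or.inl ⟨_, ⟨H, ⟨hH, hle⟩, rfl⟩, rfl⟩, map_prodEquivOfIsCompl_prod_top h hle⟩
    · rintro ⟨_, ⟨_, ⟨H', ⟨hH, hle⟩, rfl⟩, rfl⟩ | ⟨_, ⟨H', ⟨hH, hle⟩, rfl⟩, rfl⟩, rfl⟩
      · beta_reduce
        rwa [map_prodEquivOfIsCompl_prod_top h hle]
      · beta_reduce
        rwa [map_prodEquivOfIsCompl_top_prod h hle]

end Reducibility

end CentralArrangement

namespace CentralArrangement

/-! ### Bases of the dual space and their dual vectors -/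

section LinearForms

variable {K V ι : Type*} [Field K] [AddCommGroup V] [Module K V]

theorem exists_ker_eq_of_isCoatom {H : Submodule K V} (hH : IsCoatom H) :
    ∃ α : Module.Dual K V, LinearMap.ker α = H := by
  obtain ⟨α, hα, hle⟩ := Submodule.exists_le_ker_of_lt_top H hH.lt_top
  refine ⟨α, ?_⟩
  by_contra hne
  have := hH.2 _ (lt_of_le_of_ne hle (Ne.symm hne))
  exact hα (LinearMap.ker_eq_top.1 this)

theorem linearIndependent_basis_triple (b : Module.Basis ι K (Module.Dual K V)) {i j k : ι}
    (hij : i ≠ j) (hik : i ≠ k) (hjk : j ≠ k) : LinearIndependent K ![b i, b j, b k] := by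
  have hinj : Function.Injective ![i, j, k] := by
    intro x y
    fin_cases x <;> fin_cases y <;> simp [hij, hik, hjk, hij.symm, hik.symm, hjk.symm]
  convert b.linearIndependent.comp _ hinj using 1
  ext x : 1
  fin_cases x <;> rfl

theorem apply_eq_sum_repr [Fintype ι] (b : Module.Basis ι K (Module.Dual K V))
    (α : Module.Dual K V) (x : V) : α x = ∑ i, b.repr α i * b i x := by
  conv_lhs => rw [← b.sum_repr α]
  simp only [LinearMap.sum_apply, LinearMap.smul_apply, smul_eq_mul]

variable [FiniteDimensional K V]

/-- The vectors of `V` dual to a basis of its dual space. -/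
noncomputable def dualVector (b : Module.Basis ι K (Module.Dual K V)) (i : ι) : V :=
  (Module.evalEquiv K V).symm (b.coord i)

theorem apply_dualVector (b : Module.Basis ι K (Module.Dual K V)) (i : ι) (α : Module.Dual K V) :
    α (dualVector b i) = b.repr α i := by
  simp [dualVector]

theorem apply_dualVector_self (b : Module.Basis ι K (Module.Dual K V)) (i : ι) :
    b i (dualVector b i) = 1 := by
  simp [apply_dualVector]

theorem apply_dualVector_of_ne (b : Module.Basis ι K (Module.Dual K V)) {i j : ι} (h : i ≠ j) :
    b i (dualVector b j) = 0 := by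
  simp [apply_dualVector, h]

theorem eq_zero_of_forall_basis_apply_eq_zero (b : Module.Basis ι K (Module.Dual K V)) {x : V}
    (h : ∀ i, b i x = 0) : x = 0 := by
  rw [← Module.forall_dual_apply_eq_zero_iff K]
  intro φ
  have : Module.Dual.eval K V x = 0 := b.ext fun i => by simpa using h i
  simpa using LinearMap.congr_fun this φ

/-- Three linearly independent forms cut out a subspace of codimension three. -/
theorem finrank_quotient_inf_ker {f g h : Module.Dual K V}
    (hli : LinearIndependent K ![f, g, h]) :
    Module.finrank K (V ⧸ (LinearMap.ker f ⊓ LinearMap.ker g ⊓ LinearMap.ker h)) = 3 := by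
  have hW : LinearMap.ker f ⊓ LinearMap.ker g ⊓ LinearMap.ker h =
      (Submodule.span K (Set.range ![f, g, h])).dualCoannihilator := by
    ext x
    rw [← SetLike.mem_coe (p := Submodule.dualCoannihilator _),
      Submodule.coe_dualCoannihilator_span]
    simp only [Submodule.mem_inf, LinearMap.mem_ker, Set.mem_ofPred_eq, Set.forall_mem_range,
      Fin.forall_fin_succ, Matrix.cons_val_zero, Matrix.cons_val_succ, IsEmpty.forall_iff, and_true,
      and_assoc]
  have h1 := Subspace.finrank_add_finrank_dualCoannihilator_eq
    (Submodule.span K (Set.range ![f, g, h]))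
  have h2 := Submodule.finrank_quotient_add_finrank
    (LinearMap.ker f ⊓ LinearMap.ker g ⊓ LinearMap.ker h)
  have h3 := finrank_span_eq_card hli
  rw [Fintype.card_fin] at h3
  rw [← hW] at h1
  omega

/-- The dual vector at `k` kills `b i` and `b j` but not `α`, so `α` has coefficient zero in any
relation. -/
theorem linearIndependent_form_basis_pair (b : Module.Basis ι K (Module.Dual K V))
    {α : Module.Dual K V} {i j k : ι} (hij : i ≠ j) (hki : k ≠ i) (hkj : k ≠ j)
    (hk : b.repr α k ≠ 0) : LinearIndependent K ![α, b i, b j] := by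
  rw [Fintype.linearIndependent_iff]
  intro g hg
  simp only [Fin.sum_univ_three, Matrix.cons_val_zero, Matrix.cons_val_one, Matrix.cons_val] at hg
  have key : ∀ m, g 0 * b.repr α m + g 1 * b i (dualVector b m) + g 2 * b j (dualVector b m) = 0 := by
    intro m
    have := LinearMap.congr_fun hg (dualVector b m)
    simpa [apply_dualVector] using this
  have h0 : g 0 = 0 := by
    have := key k
    rw [apply_dualVector_of_ne b hki.symm, apply_dualVector_of_ne b hkj.symm] at this
    simpa [hk] using this
  have h1 : g 1 = 0 := by
    have := key i
    rw [apply_dualVector_self, apply_dualVector_of_ne b hij.symm] at this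
    simpa [h0] using this
  have h2 : g 2 = 0 := by
    have := key j
    rw [apply_dualVector_self, apply_dualVector_of_ne b hij] at this
    simpa [h0] using this
  intro m
  fin_cases m <;> assumption

end LinearForms

/-! ### Finding a basis and a form with at least three nonzero coordinates -/

section Extraction

variable {K V : Type*} [Field K] [AddCommGroup V] [Module K V] [FiniteDimensional K V]

/-- An arrangement whose defining forms are supported on one of two blocks of a basis of the dual
space is reducible. -/
theorem isReducible_of_support {ι : Type*} [Fintype ι] (A : CentralArrangement K V)
    (b : Module.Basis ι K (Module.Dual K V)) (T : Set ι) (hT : T.Nonempty) (hT' : Tᶜ.Nonempty)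
    (h : ∀ α : Module.Dual K V, LinearMap.ker α ∈ A.hyperplanes →
      (∀ i ∈ T, b.repr α i = 0) ∨ ∀ i ∉ T, b.repr α i = 0) : A.IsReducible := by
  classical
  have mem (S : Set ι) (x : V) : x ∈ (⨅ i ∈ S, LinearMap.ker (b i)) ↔ ∀ i ∈ S, b i x = 0 := by
    simp
  have ne_bot (S : Set ι) {i : ι} (hi : i ∉ S) : (⨅ j ∈ S, LinearMap.ker (b j)) ≠ ⊥ := by
    intro hbot
    have hm : dualVector b i ∈ (⨅ j ∈ S, LinearMap.ker (b j)) :=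
      (mem _ _).2 fun j hj => apply_dualVector_of_ne b fun e => hi (e ▸ hj)
    rw [hbot, Submodule.mem_bot] at hm
    have := apply_dualVector_self b i
    simp [hm] at this
  obtain ⟨i₀, hi₀⟩ := hT
  obtain ⟨j₀, hj₀⟩ := hT'
  -- `V₁` is cut out by the basis forms outside `T`, so a form whose coordinates vanish on `T`
  -- vanishes on `V₁`.
  refine A.isReducible_of_isCompl (V₁ := ⨅ i ∈ Tᶜ, LinearMap.ker (b i))
    (V₂ := ⨅ i ∈ T, LinearMap.ker (b i)) ⟨?_, ?_⟩ (ne_bot _ (not_not.2 hi₀)) (ne_bot _ hj₀) ?_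
  · rw [Submodule.disjoint_def]
    intro x h1 h2
    rw [mem] at h1 h2
    refine eq_zero_of_forall_basis_apply_eq_zero b fun i => ?_
    by_cases hi : i ∈ T
    · exact h2 i hi
    · exact h1 i hi
  · rw [codisjoint_iff, eq_top_iff]
    intro x _
    have hy (j : ι) : b j (∑ i, if i ∈ T then b i x • dualVector b i else 0) =
        if j ∈ T then b j x else 0 := by
      rw [map_sum, Finset.sum_eq_single j]
      · split_ifs <;> simp [apply_dualVector_self]
      · intro i _ hij
        split_ifs <;> simp [apply_dualVector_of_ne b hij.symm]
      · simp
    rw [Submodule.mem_sup]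
    refine ⟨_, (mem _ _).2 fun j hj => ?_, x - ∑ i, (if i ∈ T then b i x • dualVector b i else 0),
      (mem _ _).2 fun j hj => ?_, add_sub_cancel _ x⟩
    · rw [hy, if_neg hj]
    · rw [map_sub, hy, if_pos hj, sub_self]
  · intro H hH
    obtain ⟨α, rfl⟩ := exists_ker_eq_of_isCoatom (A.isHyperplane H hH)
    rcases h α hH with h | h
    · left
      intro x hx
      rw [mem] at hx
      rw [LinearMap.mem_ker, apply_eq_sum_repr b]
      refine Finset.sum_eq_zero fun i _ => ?_
      by_cases hi : i ∈ T
      · rw [h i hi, zero_mul]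
      · rw [hx i hi, mul_zero]
    · right
      intro x hx
      rw [mem] at hx
      rw [LinearMap.mem_ker, apply_eq_sum_repr b]
      refine Finset.sum_eq_zero fun i _ => ?_
      by_cases hi : i ∈ T
      · rw [hx i hi, mul_zero]
      · rw [h i hi, zero_mul]

/-- The forms defining an irreducible arrangement in dimension at least two span the dual space. -/
theorem span_forms_eq_top (A : CentralArrangement K V) (hA : A.IsIrreducible)
    (hV : 2 ≤ Module.finrank K V) :
    Submodule.span K {α : Module.Dual K V | LinearMap.ker α ∈ A.hyperplanes} = ⊤ := by
  set W := Submodule.span K {α : Module.Dual K V | LinearMap.ker α ∈ A.hyperplanes} with hW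
  by_contra hne
  have hco : W.dualCoannihilator ≠ ⊥ := fun h0 => by
    have := Subspace.dualCoannihilator_dualAnnihilator_eq (W := W)
    rw [h0, Submodule.dualAnnihilator_bot] at this
    exact hne this.symm
  -- The line spanned by a common zero `v` lies in every hyperplane and splits off; dimension at
  -- least two keeps its complement nonzero.
  obtain ⟨v, hv, hv0⟩ := (Submodule.ne_bot_iff _).1 hco
  obtain ⟨V₁, hV₁⟩ := Submodule.exists_isCompl (Submodule.span K {v})
  refine hA (A.isReducible_of_isCompl hV₁ (by simpa using hv0) ?_ fun H hH => Or.inl ?_)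
  · rintro rfl
    have h1 := (Submodule.finrank_add_eq_of_isCompl hV₁)
    have h2 := finrank_span_singleton (K := K) hv0
    rw [h2, finrank_bot] at h1
    omega
  · obtain ⟨α, rfl⟩ := exists_ker_eq_of_isCoatom (A.isHyperplane H hH)
    rw [Submodule.span_singleton_le_iff_mem, LinearMap.mem_ker]
    exact (Submodule.mem_dualCoannihilator v).1 hv α (Submodule.subset_span hH)

theorem exists_basis_of_isIrreducible (A : CentralArrangement K V) (hA : A.IsIrreducible)
    (hV : 2 ≤ Module.finrank K V) :
    ∃ b : Module.Basis (Fin (Module.finrank K V)) K (Module.Dual K V),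
      ∀ i, LinearMap.ker (b i) ∈ A.hyperplanes := by
  obtain ⟨s, hs, hspan, hli⟩ :=
    exists_linearIndependent K {α : Module.Dual K V | LinearMap.ker α ∈ A.hyperplanes}
  rw [span_forms_eq_top A hA hV] at hspan
  let b := Module.Basis.mk hli (by simp [hspan])
  have := hli.finite
  have := Fintype.ofFinite s
  have hcard : Fintype.card s = Module.finrank K V := by
    rw [← Module.finrank_eq_card_basis b, Subspace.dual_finrank_eq]
  refine ⟨b.reindex (Fintype.equivFinOfCardEq hcard), fun i => ?_⟩
  simpa [b] using hs (Subtype.coe_prop _)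

/-- An irreducible arrangement in dimension at least three contains a basis together with a
hyperplane whose defining form involves at least three of the basis forms. -/
theorem exists_basis_and_form (A : CentralArrangement K V) (hA : A.IsIrreducible)
    (hV : 3 ≤ Module.finrank K V) :
    ∃ (b : Module.Basis (Fin (Module.finrank K V)) K (Module.Dual K V)) (α : Module.Dual K V)
      (i j k : Fin (Module.finrank K V)),
      (∀ i, LinearMap.ker (b i) ∈ A.hyperplanes) ∧ LinearMap.ker α ∈ A.hyperplanes ∧
      i ≠ j ∧ i ≠ k ∧ j ≠ k ∧ b.repr α i ≠ 0 ∧ b.repr α j ≠ 0 ∧ b.repr α k ≠ 0 := by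
  classical
  obtain ⟨b, hb⟩ := A.exists_basis_of_isIrreducible hA (by omega)
  by_contra hcon
  have small : ∀ α : Module.Dual K V, LinearMap.ker α ∈ A.hyperplanes → ∀ i j k,
      i ≠ j → i ≠ k → j ≠ k → b.repr α i ≠ 0 → b.repr α j ≠ 0 → b.repr α k = 0 := by
    intro α hα i j k hij hik hjk hi hj
    by_contra hk
    exact hcon ⟨b, α, i, j, k, hb, hα, hij, hik, hjk, hi, hj, hk⟩
  -- Call two indices adjacent if some form of `A` involves both. Each index has at most one
  -- neighbour: were `j ≠ k` both adjacent to `i`, replacing `b i` by `α` would give `β` nonzero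
  -- coordinates at `i`, `j` and `k`.
  have nbr : ∀ α β : Module.Dual K V, LinearMap.ker α ∈ A.hyperplanes →
      LinearMap.ker β ∈ A.hyperplanes → ∀ i j k, i ≠ j → i ≠ k → b.repr α i ≠ 0 →
      b.repr α j ≠ 0 → b.repr β i ≠ 0 → b.repr β k ≠ 0 → j = k := by
    intro α β hα hβ i j k hij hik hαi hαj hβi hβk
    by_contra hjk
    have hαe : α = b.repr α i • b i + b.repr α j • b j := by
      apply b.repr.injective
      ext m
      rcases eq_or_ne m i with rfl | hmi
      · simp [hij.symm]
      rcases eq_or_ne m j with rfl | hmj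
      · simp [hij]
      · simp [small α hα i j m hij hmi.symm hmj.symm hαi hαj, hmi.symm, hmj.symm]
    have hβe : β = b.repr β i • b i + b.repr β k • b k := by
      apply b.repr.injective
      ext m
      rcases eq_or_ne m i with rfl | hmi
      · simp [hik.symm]
      rcases eq_or_ne m k with rfl | hmk
      · simp [hik]
      · simp [small β hβ i k m hik hmi.symm hmk.symm hβi hβk, hmi.symm, hmk.symm]
    have hbi : b i = (b.repr α i)⁻¹ • α - ((b.repr α i)⁻¹ * b.repr α j) • b j := by
      nth_rw 2 [hαe]
      rw [smul_add, smul_smul, smul_smul, inv_mul_cancel₀ hαi, one_smul, add_sub_cancel_right]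
    have hup {m : Fin (Module.finrank K V)} (hm : i ≠ m) : Function.update b i α m = b m :=
      Function.update_of_ne hm.symm _ _
    have hspan : ⊤ ≤ Submodule.span K (Set.range (Function.update b i α)) := by
      have hmem (m) : Function.update b i α m ∈
          Submodule.span K (Set.range (Function.update b i α)) :=
        Submodule.subset_span ⟨m, rfl⟩
      have hα' := hmem i
      rw [Function.update_self] at hα'
      rw [← b.span_eq, Submodule.span_le]
      rintro _ ⟨m, rfl⟩
      rcases eq_or_ne i m with rfl | hm
      · have hj := hmem j
        rw [hup hij] at hj
        rw [hbi]
        exact Submodule.sub_mem _ (Submodule.smul_mem _ _ hα') (Submodule.smul_mem _ _ hj)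
      · rw [← hup hm]
        exact hmem m
    let b' := basisOfTopLeSpanOfCardEqFinrank _ hspan (by simp [Subspace.dual_finrank_eq])
    have hb' (m) : b' m = Function.update b i α m := by simp [b']
    have hβ' : β = (b.repr β i * (b.repr α i)⁻¹) • b' i -
        (b.repr β i * (b.repr α i)⁻¹ * b.repr α j) • b' j + b.repr β k • b' k := by
      rw [hb', hb', hb', Function.update_self, hup hij, hup hik]
      conv_lhs => rw [hβe, hbi, smul_sub, smul_smul, smul_smul, ← mul_assoc]
    have hrepr (m) : b'.repr β m = (b.repr β i * (b.repr α i)⁻¹) * b'.repr (b' i) m -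
        (b.repr β i * (b.repr α i)⁻¹ * b.repr α j) * b'.repr (b' j) m +
          b.repr β k * b'.repr (b' k) m := by
      conv_lhs => rw [hβ']
      simp only [map_add, map_sub, map_smul, Finsupp.add_apply, Finsupp.sub_apply,
        Finsupp.smul_apply, smul_eq_mul]
    simp only [Module.Basis.repr_self, Finsupp.single_apply] at hrepr
    refine hcon ⟨b', β, i, j, k, fun m => ?_, hβ, hij, hik, hjk, ?_, ?_, ?_⟩
    · rw [hb']
      rcases eq_or_ne i m with rfl | hm
      · rwa [Function.update_self]
      · rw [hup hm]
        exact hb m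
    · simp [hrepr, hij.symm, hik.symm, hαi, hβi]
    · simp [hrepr, hij, Ne.symm hjk, hαi, hβi, hαj]
    · simp [hrepr, hik, hjk, hβk]
  let i₀ : Fin (Module.finrank K V) := ⟨0, by omega⟩
  -- `T` is the component of `i₀`. It has at most two elements by `nbr`, so it misses index 1 or 2.
  let T : Set (Fin (Module.finrank K V)) := {m | m = i₀ ∨ ∃ α : Module.Dual K V,
    LinearMap.ker α ∈ A.hyperplanes ∧ b.repr α i₀ ≠ 0 ∧ b.repr α m ≠ 0}
  refine hA (A.isReducible_of_support b T ⟨i₀, Or.inl rfl⟩ ?_ ?_)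
  · by_contra hT
    rw [Set.not_nonempty_iff_eq_empty, Set.compl_empty_iff] at hT
    have h1 : (⟨1, by omega⟩ : Fin (Module.finrank K V)) ∈ T := hT ▸ Set.mem_univ _
    have h2 : (⟨2, by omega⟩ : Fin (Module.finrank K V)) ∈ T := hT ▸ Set.mem_univ _
    rcases h1 with h1 | ⟨α, hα, hα0, hα1⟩
    · simp [i₀] at h1
    rcases h2 with h2 | ⟨β, hβ, hβ0, hβ2⟩
    · simp [i₀] at h2
    have := nbr α β hα hβ i₀ _ _ (by simp [i₀]) (by simp [i₀]) hα0 hα1 hβ0 hβ2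
    simp at this
  · intro α hα
    by_contra! hne
    obtain ⟨⟨i, hiT, hi⟩, m, hmT, hm⟩ := hne
    rcases eq_or_ne i i₀ with rfl | hi0
    · exact hmT (Or.inr ⟨α, hα, hi, hm⟩)
    rcases hiT with h | ⟨β, hβ, hβ0, hβi⟩
    · exact hi0 h
    have := nbr β α hβ hα i i₀ m hi0 (fun e => hmT (e ▸ Or.inr ⟨β, hβ, hβ0, hβi⟩)) hβi hβ0 hi hm
    exact hmT (Or.inl this.symm)

end Extraction

end CentralArrangement

namespace CentralArrangement

/-! ### Linear forms as polynomials, and regularity by substitution -/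

section LinearFormPoly

open MvPolynomial

variable {K : Type*} [Field K] {l : ℕ}

theorem linearFormPoly_add (α β : Module.Dual K (Fin l → K)) :
    linearFormPoly (α + β) = linearFormPoly α + linearFormPoly β := by
  simp [linearFormPoly, add_mul, Finset.sum_add_distrib]

theorem linearFormPoly_smul (c : K) (α : Module.Dual K (Fin l → K)) :
    linearFormPoly (c • α) = C c * linearFormPoly α := by
  simp [linearFormPoly, Finset.mul_sum, mul_assoc]

/-- `linearFormPoly` as a linear map. -/
noncomputable def linearFormPolyHom : Module.Dual K (Fin l → K) →ₗ[K] MvPolynomial (Fin l) K where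
  toFun := linearFormPoly
  map_add' := linearFormPoly_add
  map_smul' c α := by rw [linearFormPoly_smul, RingHom.id_apply, smul_eq_C_mul]

theorem linearFormPolyHom_apply (α : Module.Dual K (Fin l → K)) :
    linearFormPolyHom α = linearFormPoly α := rfl

theorem linearFormPoly_proj (i : Fin l) :
    linearFormPoly (LinearMap.proj i : Module.Dual K (Fin l → K)) = X i := by
  rw [linearFormPoly, Finset.sum_eq_single i]
  · simp
  · intro j _ hj
    simp [hj.symm]
  · simp

theorem constantCoeff_linearFormPoly (α : Module.Dual K (Fin l → K)) :
    constantCoeff (linearFormPoly α) = 0 := by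
  simp [linearFormPoly]

theorem apply_eq_sum_single (α : Module.Dual K (Fin l → K)) (v : Fin l → K) :
    α v = ∑ i, α (Pi.single i 1) * v i := by
  conv_lhs => rw [pi_eq_sum_univ' v]
  simp [mul_comm]

/-- The derivation of the polynomial ring in the direction of a vector. -/
noncomputable def directionalDerivation (v : Fin l → K) :
    Derivation K (MvPolynomial (Fin l) K) (MvPolynomial (Fin l) K) :=
  mkDerivation K fun i => C (v i)

theorem directionalDerivation_linearFormPoly (v : Fin l → K) (α : Module.Dual K (Fin l → K)) :
    directionalDerivation v (linearFormPoly α) = C (α v) := by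
  simp only [linearFormPoly, map_sum, Derivation.leibniz, directionalDerivation, mkDerivation_X,
    derivation_C, mul_zero, zero_add, smul_eq_mul, apply_eq_sum_single α v, C_mul, mul_comm]

theorem linearFormPoly_ne_zero {α : Module.Dual K (Fin l → K)} (hα : α ≠ 0) :
    linearFormPoly α ≠ 0 := by
  intro h
  refine hα (LinearMap.ext fun v => ?_)
  have := directionalDerivation_linearFormPoly v α
  rw [h, map_zero] at this
  simpa using this.symm

/-- Substitution in a polynomial of a linear endomorphism of the affine space. -/
noncomputable def linearSubst (π : (Fin l → K) →ₗ[K] (Fin l → K)) :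
    MvPolynomial (Fin l) K →ₐ[K] MvPolynomial (Fin l) K :=
  aeval fun i => linearFormPoly (LinearMap.proj i ∘ₗ π)

theorem linearSubst_linearFormPoly (π : (Fin l → K) →ₗ[K] (Fin l → K))
    (α : Module.Dual K (Fin l → K)) :
    linearSubst π (linearFormPoly α) = linearFormPoly (α ∘ₗ π) := by
  have hα : α ∘ₗ π = ∑ i, α (Pi.single i 1) • (LinearMap.proj i ∘ₗ π) := by
    refine LinearMap.ext fun v => ?_
    simpa using apply_eq_sum_single α (π v)
  rw [hα, ← linearFormPolyHom_apply (∑ i, _), map_sum]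
  simp [linearFormPoly, linearSubst, linearFormPolyHom_apply, smul_eq_C_mul, algebraMap_eq]

/-- Substituting `π` changes a polynomial only modulo the forms that measure `id - π`. -/
theorem sub_linearSubst_mem (π : (Fin l → K) →ₗ[K] (Fin l → K)) (I : Ideal (MvPolynomial (Fin l) K))
    (hI : ∀ α : Module.Dual K (Fin l → K), linearFormPoly (α - α ∘ₗ π) ∈ I)
    (q : MvPolynomial (Fin l) K) : q - linearSubst π q ∈ I := by
  rw [← Ideal.Quotient.eq]
  have : (Ideal.Quotient.mkₐ K I) = (Ideal.Quotient.mkₐ K I).comp (linearSubst π) := by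
    refine algHom_ext fun i => ?_
    rw [AlgHom.comp_apply, Ideal.Quotient.mkₐ_eq_mk, Ideal.Quotient.eq, ← linearFormPoly_proj,
      linearSubst_linearFormPoly, ← linearFormPolyHom_apply, ← linearFormPolyHom_apply, ← map_sub]
    exact hI _
  exact DFunLike.congr_fun this q

variable {ι : Type*} (b : Module.Basis ι K (Module.Dual K (Fin l → K)))

/-- A basis form is a nonzerodivisor modulo the ideal generated by two other basis forms. -/
theorem mem_span_pair_of_basis_mul_mem {i j k : ι} (hij : i ≠ j) (hik : i ≠ k) (hjk : j ≠ k)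
    {q : MvPolynomial (Fin l) K}
    (hq : linearFormPoly (b i) * q ∈
      Ideal.span {linearFormPoly (b j), linearFormPoly (b k)}) :
    q ∈ Ideal.span {linearFormPoly (b j), linearFormPoly (b k)} := by
  -- `π` projects onto the common kernel of `b j` and `b k`. Its substitution kills these two forms,
  -- fixes `b i`, and is the identity modulo the ideal; hence it kills `q`, and `q` lies in the
  -- ideal.
  let π : (Fin l → K) →ₗ[K] (Fin l → K) := LinearMap.id -
    (b j).smulRight (dualVector b j) - (b k).smulRight (dualVector b k)
  have hπ (α : Module.Dual K (Fin l → K)) :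
      α ∘ₗ π = α - b.repr α j • b j - b.repr α k • b k := by
    refine LinearMap.ext fun v => ?_
    simp [π, apply_dualVector, mul_comm]
  have hker : Ideal.span {linearFormPoly (b j), linearFormPoly (b k)} ≤
      RingHom.ker (linearSubst π) := by
    rw [Ideal.span_le]
    rintro _ (rfl | rfl)
    · rw [SetLike.mem_coe, RingHom.mem_ker, linearSubst_linearFormPoly, hπ,
        ← linearFormPolyHom_apply]
      simp [hjk]
    · rw [SetLike.mem_coe, RingHom.mem_ker, linearSubst_linearFormPoly, hπ,
        ← linearFormPolyHom_apply]
      simp [hjk.symm]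
  have h0 := hker hq
  rw [RingHom.mem_ker, map_mul, linearSubst_linearFormPoly, hπ] at h0
  have hi : b i - b.repr (b i) j • b j - b.repr (b i) k • b k = b i := by simp [hij, hik]
  rw [hi] at h0
  have h1 := (mul_eq_zero.1 h0).resolve_left (linearFormPoly_ne_zero (b.ne_zero i))
  have h2 := sub_linearSubst_mem π (Ideal.span {linearFormPoly (b j), linearFormPoly (b k)})
    (fun α => ?_) q
  · rwa [h1, sub_zero] at h2
  · rw [hπ, sub_sub, sub_sub_cancel, linearFormPoly_add, linearFormPoly_smul, linearFormPoly_smul]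
    exact add_mem (Ideal.mul_mem_left _ _ (Ideal.subset_span (by simp)))
      (Ideal.mul_mem_left _ _ (Ideal.subset_span (by simp)))

/-- A basis form dividing a multiple of another basis form divides the cofactor. -/
theorem dvd_of_dvd_basis_mul {i j : ι} (hij : i ≠ j) {q : MvPolynomial (Fin l) K}
    (hq : linearFormPoly (b j) ∣ linearFormPoly (b i) * q) : linearFormPoly (b j) ∣ q := by
  let π : (Fin l → K) →ₗ[K] (Fin l → K) := LinearMap.id - (b j).smulRight (dualVector b j)
  have hπ (α : Module.Dual K (Fin l → K)) : α ∘ₗ π = α - b.repr α j • b j := by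
    refine LinearMap.ext fun v => ?_
    simp [π, apply_dualVector, mul_comm]
  obtain ⟨r, hr⟩ := hq
  have h0 := congrArg (linearSubst π) hr
  have hi : b i - b.repr (b i) j • b j = b i := by simp [hij]
  have hj : linearFormPoly (b j - b.repr (b j) j • b j) = 0 := by
    simp [← linearFormPolyHom_apply]
  rw [map_mul, map_mul, linearSubst_linearFormPoly, linearSubst_linearFormPoly, hπ, hπ, hi, hj,
    zero_mul] at h0
  have h1 := (mul_eq_zero.1 h0).resolve_left (linearFormPoly_ne_zero (b.ne_zero i))
  have h2 := sub_linearSubst_mem π (Ideal.span {linearFormPoly (b j)}) (fun α => ?_) q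
  · rwa [h1, sub_zero, Ideal.mem_span_singleton] at h2
  · rw [hπ, sub_sub_cancel, linearFormPoly_smul]
    exact Ideal.mul_mem_left _ _ (Ideal.subset_span (by simp))

end LinearFormPoly

/-- In a free module, multiplication by an element that is a nonzerodivisor modulo `I` is
injective modulo `I`. -/
theorem mem_ideal_smul_top_of_smul_mem {R M : Type*} [CommRing R] [AddCommGroup M] [Module R M]
    [Module.Free R M] {I : Ideal R} {r : R} (hr : ∀ q, r * q ∈ I → q ∈ I) {u : M}
    (hu : r • u ∈ I • (⊤ : Submodule R M)) : u ∈ I • (⊤ : Submodule R M) := by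
  let b := Module.Free.chooseBasis R M
  have key (φ : M →ₗ[R] R) {x : M} (hx : x ∈ I • (⊤ : Submodule R M)) : φ x ∈ I := by
    refine Submodule.smul_induction_on hx (fun a ha n _ => ?_) fun x y hx hy => ?_
    · rw [map_smul, smul_eq_mul]
      exact I.mul_mem_right _ ha
    · rw [map_add]
      exact I.add_mem hx hy
  rw [← b.linearCombination_repr u, Finsupp.linearCombination_apply]
  refine Submodule.sum_mem _ fun i _ => Submodule.smul_mem_smul (hr _ ?_) trivial
  have := key (b.coord i) hu
  simpa using this

end CentralArrangement

namespace CentralArrangement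

/-! ### The Koszul relation and failure of freeness -/

section Freeness

open MvPolynomial

variable {K : Type*} [Field K] {l : ℕ}

theorem exists_smul_eq_of_ker_le_ker {V : Type*} [AddCommGroup V] [Module K V]
    {α β : Module.Dual K V} (h : LinearMap.ker α ≤ LinearMap.ker β) : ∃ c : K, β = c • α := by
  by_cases hα : α = 0
  · refine ⟨0, LinearMap.ext fun x => ?_⟩
    have hx : x ∈ LinearMap.ker α := by simp [hα]
    simpa using h hx
  · obtain ⟨v, hv⟩ : ∃ v, α v ≠ 0 := by
      by_contra! h0
      exact hα (LinearMap.ext h0)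
    refine ⟨β v / α v, LinearMap.ext fun x => ?_⟩
    have hx : x - (α x / α v) • v ∈ LinearMap.ker α := by simp [hv]
    have hβ := h hx
    rw [LinearMap.mem_ker, map_sub, map_smul, sub_eq_zero] at hβ
    rw [hβ, LinearMap.smul_apply, smul_eq_mul, smul_eq_mul]
    ring

/-- Membership in the module of logarithmic derivations can be tested on one form per
hyperplane. -/
theorem mem_logDerivations_one {B : CentralArrangement K (Fin l → K)}
    {θ : Derivation K (MvPolynomial (Fin l) K) (MvPolynomial (Fin l) K)}
    (h : ∀ H ∈ B.hyperplanes, ∃ α : Module.Dual K (Fin l → K), LinearMap.ker α = H ∧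
      linearFormPoly α ∣ θ (linearFormPoly α)) :
    θ ∈ B.logDerivations (fun _ => 1) := by
  intro H β hβ
  obtain ⟨α, hα, hdvd⟩ := h H H.2
  obtain ⟨c, rfl⟩ := exists_smul_eq_of_ker_le_ker (hα.trans hβ.symm).le
  rw [linearFormPoly_smul, ← smul_eq_C_mul, Derivation.map_smul, smul_eq_C_mul, smul_eq_C_mul,
    PNat.one_coe, pow_one]
  exact mul_dvd_mul_left _ hdvd

theorem dvd_of_mem_logDerivations_one {B : CentralArrangement K (Fin l → K)}
    {θ : Derivation K (MvPolynomial (Fin l) K) (MvPolynomial (Fin l) K)}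
    (hθ : θ ∈ B.logDerivations (fun _ => 1)) {α : Module.Dual K (Fin l → K)}
    (hα : LinearMap.ker α ∈ B.hyperplanes) :
    linearFormPoly α ∣ θ (linearFormPoly α) := by
  simpa using hθ ⟨_, hα⟩ α rfl

theorem constantCoeff_eq_zero_of_dvd {α : Module.Dual K (Fin l → K)} {q : MvPolynomial (Fin l) K}
    (h : linearFormPoly α ∣ q) : constantCoeff q = 0 := by
  obtain ⟨r, rfl⟩ := h
  rw [map_mul, constantCoeff_linearFormPoly, zero_mul]

/-- Reads off the linear part of a product, which is `α` times the constant term of `q`. -/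
theorem constantCoeff_directionalDerivation_mul (v : Fin l → K) (α : Module.Dual K (Fin l → K))
    (q : MvPolynomial (Fin l) K) :
    constantCoeff (directionalDerivation v (linearFormPoly α * q)) = α v * constantCoeff q := by
  rw [Derivation.leibniz, directionalDerivation_linearFormPoly]
  simp [constantCoeff_linearFormPoly, mul_comm]

theorem linearFormPoly_eq_sum {ι : Type*} [Fintype ι]
    (b : Module.Basis ι K (Module.Dual K (Fin l → K))) (α : Module.Dual K (Fin l → K)) :
    linearFormPoly α = ∑ m, b.repr α m • linearFormPoly (b m) := by
  conv_lhs => rw [← b.sum_repr α, ← linearFormPolyHom_apply, map_sum]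
  simp [linearFormPolyHom_apply]

/-- In a free module, a relation `r • u = a • x + c • y` with `r` a nonzerodivisor modulo `(a, c)`
forces `u` to be a combination of the same shape. -/
theorem exists_eq_smul_add_smul_of_smul_eq {R M : Type*} [CommRing R] [AddCommGroup M]
    [Module R M] [Module.Free R M] {r a c : R}
    (hr : ∀ q, r * q ∈ Ideal.span {a, c} → q ∈ Ideal.span {a, c}) {u x y : M}
    (h : r • u = a • x + c • y) : ∃ w z : M, u = a • w + c • z := by
  have hu : u ∈ Ideal.span {a, c} • (⊤ : Submodule R M) := by
    refine mem_ideal_smul_top_of_smul_mem hr ?_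
    rw [h]
    exact add_mem (Submodule.smul_mem_smul (Ideal.subset_span (by simp)) trivial)
      (Submodule.smul_mem_smul (Ideal.subset_span (by simp)) trivial)
  rw [Ideal.span_insert, Submodule.sup_smul, Submodule.mem_sup] at hu
  obtain ⟨s, hs, t, ht, rfl⟩ := hu
  rw [Submodule.ideal_span_singleton_smul, Submodule.mem_smul_pointwise_iff_exists] at hs ht
  obtain ⟨w, -, rfl⟩ := hs
  obtain ⟨z, -, rfl⟩ := ht
  exact ⟨w, z, rfl⟩

/-- Let `B` consist of a basis and one more hyperplane, whose defining form involves at least three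
of the basis forms. Then `B` is not free: the syzygy of Koszul type between three logarithmic
derivations would have to be trivial. -/
theorem not_isFree_of_basis_form {ι : Type*} [Fintype ι] (B : CentralArrangement K (Fin l → K))
    (b : Module.Basis ι K (Module.Dual K (Fin l → K))) (α : Module.Dual K (Fin l → K))
    (hB : B.hyperplanes = insert (LinearMap.ker α) (Set.range fun i => LinearMap.ker (b i)))
    {i j k : ι} (hij : i ≠ j) (hik : i ≠ k) (hjk : j ≠ k) (hi : b.repr α i ≠ 0)
    (hj : b.repr α j ≠ 0) (hk : b.repr α k ≠ 0) : ¬ B.IsFree := by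
  classical
  intro hfree
  have : Module.Free (MvPolynomial (Fin l) K) (B.logDerivations fun _ => 1) := hfree
  have hBα : LinearMap.ker α ∈ B.hyperplanes := by simp [hB]
  have hBb (m : ι) : LinearMap.ker (b m) ∈ B.hyperplanes := by simp [hB]
  let p (m : ι) := linearFormPoly (b m)
  -- Scaled so that `D m` sends `α` to 1 when its coordinate at `m` is nonzero; differences of such
  -- derivations then kill `α`.
  let D (m : ι) := directionalDerivation ((b.repr α m)⁻¹ • dualVector b m)
  have hD (m : ι) (β : Module.Dual K (Fin l → K)) :
      D m (linearFormPoly β) = C ((b.repr α m)⁻¹ * b.repr β m) := by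
    simp only [D, directionalDerivation_linearFormPoly, map_smul, apply_dualVector, smul_eq_mul]
  have hDα {m : ι} (hm : b.repr α m ≠ 0) : D m (linearFormPoly α) = 1 := by
    rw [hD, inv_mul_cancel₀ hm, C_1]
  have hDne {m n : ι} (hmn : n ≠ m) : D m (p n) = 0 := by
    rw [hD, b.repr_self, Finsupp.single_eq_of_ne hmn.symm, mul_zero, C_0]
  have hDself (m : ι) : D m (p m) = C (b.repr α m)⁻¹ := by
    rw [hD, b.repr_self, Finsupp.single_eq_same, mul_one]
  have hU {m n : ι} (hm : b.repr α m ≠ 0) (hn : b.repr α n ≠ 0) :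
      (p m * p n) • (D n - D m) ∈ B.logDerivations fun _ => 1 := by
    refine mem_logDerivations_one fun H hH => ?_
    rw [hB] at hH
    rcases hH with rfl | ⟨r, rfl⟩
    · refine ⟨α, rfl, ?_⟩
      simp [hDα hm, hDα hn]
    · refine ⟨b r, rfl, ?_⟩
      change p r ∣ ((p m * p n) • (D n - D m)) (p r)
      rw [Derivation.smul_apply, smul_eq_mul]
      rcases eq_or_ne r m with rfl | hrm
      · exact Dvd.dvd.mul_right (dvd_mul_right _ _) _
      rcases eq_or_ne r n with rfl | hrn
      · exact Dvd.dvd.mul_right (dvd_mul_left _ _) _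
      · simp [hDne hrm, hDne hrn]
  let u : B.logDerivations fun _ => 1 := ⟨_, hU hj hk⟩
  let u' : B.logDerivations fun _ => 1 := ⟨_, hU hk hi⟩
  let u'' : B.logDerivations fun _ => 1 := ⟨_, hU hi hj⟩
  -- All three terms carry the factor `p i * p j * p k`, and the differences of `D i`, `D j`, `D k`
  -- sum to zero cyclically.
  have hsyz : p i • u = p j • (-u') + p k • (-u'') := by
    apply Subtype.ext
    simp only [u, u', u'', Submodule.coe_add, Submodule.coe_smul, Submodule.coe_neg, smul_neg,
      smul_smul, smul_sub, mul_comm, mul_left_comm]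
    abel
  obtain ⟨w, w', hw⟩ := exists_eq_smul_add_smul_of_smul_eq
    (M := B.logDerivations fun _ => 1) (r := p i) (a := p j) (c := p k)
    (fun q hq => mem_span_pair_of_basis_mul_mem b hij hik hjk hq) hsyz
  have hw (q : MvPolynomial (Fin l) K) :
      p j * p k * (D k q - D j q) = p j * w.1 q + p k * w'.1 q := by
    have := congrArg (fun θ => θ.1 q) hw
    simpa [u] using this
  choose g hg using fun m => dvd_of_mem_logDerivations_one w.2 (hBb m)
  choose g' hg' using fun m => dvd_of_mem_logDerivations_one w'.2 (hBb m)
  obtain ⟨h, hh⟩ := dvd_of_mem_logDerivations_one w.2 hBα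
  have hp (m : ι) : p m ≠ 0 := linearFormPoly_ne_zero (b.ne_zero m)
  have hgk : constantCoeff (g k) = (b.repr α k)⁻¹ := by
    have h1 := hw (p k)
    rw [hDself, hDne hjk.symm, hg, hg'] at h1
    have h2 : p j * (C (b.repr α k)⁻¹ - g k) = p k * g' k := by
      apply mul_left_cancel₀ (hp k)
      linear_combination h1
    have h3 := constantCoeff_eq_zero_of_dvd (dvd_of_dvd_basis_mul b hjk ⟨_, h2⟩)
    rw [map_sub, constantCoeff_C, sub_eq_zero] at h3
    exact h3.symm
  have hgi : constantCoeff (g i) = 0 := by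
    have h1 := hw (p i)
    rw [hDne hij, hDne hik, hg, hg'] at h1
    have h2 : p j * g i = p k * (- g' i) := by
      apply mul_left_cancel₀ (hp i)
      linear_combination - h1
    exact constantCoeff_eq_zero_of_dvd (dvd_of_dvd_basis_mul b hjk ⟨_, h2⟩)
  -- Compare linear parts in `w(α) = α * h`, expanding `α` in the basis.
  have hconst {n : ι} (hn : b.repr α n ≠ 0) : constantCoeff (g n) = constantCoeff h := by
    have h1 : ∑ m, b.repr α m • (p m * g m) = linearFormPoly α * h := by
      rw [← hh, linearFormPoly_eq_sum b α, map_sum]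
      exact Finset.sum_congr rfl fun m _ => by rw [Derivation.map_smul, hg]
    have h2 := congrArg (fun q => constantCoeff (directionalDerivation (dualVector b n) q)) h1
    simp only [map_sum, Derivation.map_smul, constantCoeff_smul, p,
      constantCoeff_directionalDerivation_mul, apply_dualVector, smul_eq_mul] at h2
    rw [Finset.sum_eq_single n (fun m _ hm => by simp [hm]) (by simp)] at h2
    simpa [hn] using h2
  rw [hconst hk, ← hconst hi, hgi] at hgk
  exact inv_ne_zero hk hgk.symm

end Freeness

end CentralArrangement

/-! ### Assembling the subarrangement -/

open CentralArrangement

theorem mainTheorem3 {K : Type*} [Field K] (l : ℕ) (hl : 3 ≤ l)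
    (A : CentralArrangement K (Fin l → K)) (hA : A.IsIrreducible) :
    ∃ B : CentralArrangement K (Fin l → K),
      B.IsSubarrangement A ∧
      B.hyperplanes.ncard = l + 1 ∧
      (∀ H₁ ∈ B.hyperplanes, ∀ H₂ ∈ B.hyperplanes, ∀ H₃ ∈ B.hyperplanes,
        H₁ ≠ H₂ → H₁ ≠ H₃ → H₂ ≠ H₃ →
          Module.finrank K ((Fin l → K) ⧸ (H₁ ⊓ H₂ ⊓ H₃)) = 3) ∧
      ¬ B.IsFree := by
  have hV : Module.finrank K (Fin l → K) = l := by simp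
  obtain ⟨b, α, i, j, k, hb, hα, hij, hik, hjk, hi, hj, hk⟩ :=
    A.exists_basis_and_form hA (hV.ge.trans' hl)
  have hsub : insert (LinearMap.ker α) (Set.range fun i => LinearMap.ker (b i)) ⊆ A.hyperplanes :=
    Set.insert_subset hα (Set.range_subset_iff.2 hb)
  have third (x y) : ∃ z, b.repr α z ≠ 0 ∧ z ≠ x ∧ z ≠ y := by
    by_contra! h
    have h1 := h i hi
    have h2 := h j hj
    have h3 := h k hk
    grind
  have hinj : Function.Injective fun i => LinearMap.ker (b i) := by
    intro x y hxy
    by_contra hne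
    have hmem : dualVector b y ∈ LinearMap.ker (b x) := apply_dualVector_of_ne b hne
    rw [show LinearMap.ker (b x) = LinearMap.ker (b y) from hxy, LinearMap.mem_ker,
      apply_dualVector_self] at hmem
    exact one_ne_zero hmem
  have hnot : LinearMap.ker α ∉ Set.range fun i => LinearMap.ker (b i) := by
    rintro ⟨x, hx⟩
    obtain ⟨z, hz, hzx, -⟩ := third x x
    have hmem : dualVector b z ∈ LinearMap.ker (b x) := apply_dualVector_of_ne b hzx.symm
    rw [show LinearMap.ker (b x) = LinearMap.ker α from hx, LinearMap.mem_ker,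
      apply_dualVector] at hmem
    exact hz hmem
  refine ⟨⟨_, A.finite.subset hsub, fun H hH => A.isHyperplane H (hsub hH)⟩, hsub, ?_, ?_,
    not_isFree_of_basis_form _ b α rfl hij hik hjk hi hj hk⟩
  · rw [Set.ncard_insert_of_notMem hnot (Set.finite_range _), ← Set.image_univ,
      Set.ncard_image_of_injective _ hinj, Set.ncard_univ, Nat.card_fin, hV]
  · have hne {x y} (h : LinearMap.ker (b x) ≠ LinearMap.ker (b y)) : x ≠ y := by
      rintro rfl
      exact h rfl
    have main {x y} (hxy : LinearMap.ker (b x) ≠ LinearMap.ker (b y)) :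
        Module.finrank K ((Fin l → K) ⧸
          (LinearMap.ker α ⊓ LinearMap.ker (b x) ⊓ LinearMap.ker (b y))) = 3 := by
      obtain ⟨z, hz, hzx, hzy⟩ := third x y
      exact finrank_quotient_inf_ker
        (linearIndependent_form_basis_pair b (hne hxy) hzx hzy hz)
    -- Once repetitions of `α` are excluded, it stands first, second, third or nowhere.
    rintro _ (rfl | ⟨x, rfl⟩) _ (rfl | ⟨y, rfl⟩) _ (rfl | ⟨z, rfl⟩) h₁₂ h₁₃ h₂₃
    all_goals beta_reduce at *
    all_goals try contradiction
    · exact main h₂₃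
    · rw [inf_comm (LinearMap.ker (b x))]
      exact main h₁₃
    · rw [inf_comm, ← inf_assoc]
      exact main h₁₂
    · exact finrank_quotient_inf_ker
        (linearIndependent_basis_triple b (hne h₁₂) (hne h₁₃) (hne h₂₃))
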